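/- **Setting.** Let $K$ be an oriented knot in $S^3$ given by a diagram with at least one crossing, and let $G_K=\pi_1(S^3\setminus K)$ be its knot group, with Wirtinger generators (meridians) $m_i$ attached to the arcs of the diagram. A *parabolic representation* of $G_K$ is a homomorphism $\rho:G_K\to SL(2,\mathbb C)$ with non-abelian image such that $\operatorname{tr}\rho(m)=2$ and $\rho(m)\ne I$ for every meridian $m$. Let $X_{par}(K)$ be the set of parabolic representations modulo the relation $\rho\sim\rho'\iff \operatorname{tr}\rho(g)=\operatorname{tr}\rho'(g)$ for all $g\in G_K$, a variety with coordinates the traces $\operatorname{tr}\rho(g)$. Riley polynomials are defined when $X_{par}(K)$ is zero-dimensional; if it is not, $X_{par}(K)$ stands throughout for its zero-dimensional part, i.e. the finite set of its Zariski-isolated points. For a crossing $c$, with $m_i$ the meridian of the incoming under-arc and $m_j$ that of the over-arc, a *crossing loop* at $c$ is the loop $\alpha=m_im_j$ around both strands (up to conjugation and inversion). Put $y_c(\rho)=2-\operatorname{tr}\rho(\alpha)$; the Riley polynomial at $c$ is $$R_c(y)=\prod_{\rho\in X_{par}(K)}\bigl(y-y_c(\rho)\bigr).$$ For an irreducible component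 $X^i$ of $X_{par}(K)$ over $\mathbb Q$, put $R_c^i(y)=\prod_{\rho\in X^i}(y-y_c(\rho))$. **Theorem.** Let $K,K'$ be knots given by diagrams, $\alpha$ a crossing loop at a crossing $c$ of $K$ and $\alpha'$ a crossing loop at a crossing $c'$ of $K'$. Write $R=R_c$ and $R'=R_{c'}$ for the Riley polynomials of $K$ at $c$ and of $K'$ at $c'$. Let $\varphi:G_K\to G_{K'}$ be a homomorphism with $\varphi(\alpha)=\alpha'$, and write $\varphi^*(\rho')=\rho'\circ\varphi$. Below, irreducibility of polynomials is over $\mathbb Q$, or over any other subfield of $\mathbb C$. 1. Suppose that $\varphi^*$ is a map $X_{par}(K')\to X_{par}(K)$, i.e. that $[\rho'\circ\varphi]\in X_{par}(K)$ for every $[\rho']\in X_{par}(K')$. Then every irreducible factor of $R'(y)$ divides $R(y)$. If moreover $\varphi$ is an epimorphism, then $R'(y)\mid R(y)$. If moreover $\varphi$ is an isomorphism and $(\varphi^{-1})^*$ is likewise a map $X_{par}(K)\to X_{par}(K')$, then $R'(y)=R(y)$. 2. Let $X^i$ be an irreducible component of $X_{par}(K)$ over $\mathbb Q$ and $X'^j$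 one of $X_{par}(K')$, and suppose that $\varphi^*(X'^j)\subset X^i$. Let $R^i$ and $R'^j$ be the corresponding Riley polynomials at $c$ and $c'$. Then every irreducible factor of $R'^j(y)$ divides $R^i(y)$. If $\varphi$ is an epimorphism, then $R'^j(y)\mid R^i(y)$, and if $\varphi$ is an isomorphism, then $R'^j(y)=R^i(y)$. -/

import Mathlib

open Polynomial

noncomputable section

/-- A signed Gauss code with one component and `n ≥ 1` crossings.  Each crossing `c` is passed
twice: `(c, true)` is the passage along the over-strand, `(c, false)` the passage along the
under-strand.  `next` sends a passage to the one that follows it along the oriented knot. -/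
structure GaussCode where
  /-- number of crossings -/
  n : ℕ
  n_pos : 0 < n
  /-- the passage that follows a given one along the knot -/
  next : Equiv.Perm (Fin n × Bool)
  /-- there is one component: every passage is reached from every other one -/
  one_component : ∀ p q : Fin n × Bool, ∃ k : ℕ, (next ^ k) p = q
  /-- the sign of a crossing; `true` means positive -/
  positive : Fin n → Bool

namespace GaussCode

variable (D : GaussCode)

/-- Half-edges: `(p, true)` leaves the passage `p`, `(p, false)` arrives at the passage `p`. -/
abbrev HalfEdge : Type := (Fin D.n × Bool) × Bool

/-- The other half of the same edge. -/
def flip : D.HalfEdge → D.HalfEdge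
  | (p, true) => (D.next p, false)
  | (p, false) => (D.next.symm p, true)

/-- The next half-edge in counterclockwise order around a crossing.  At a positive crossing this
order is over-out, under-out, over-in, under-in; at a negative crossing it is over-out, under-in,
over-in, under-out. -/
def rot : D.HalfEdge → D.HalfEdge
  | ((c, true), d) => ((c, false), if D.positive c then d else !d)
  | ((c, false), d) => ((c, true), if D.positive c then !d else d)

/-- The faces of the surface determined by the code: orbits of `rot ∘ flip`. -/
def Face : Type := Quot fun x y : D.HalfEdge => D.rot (D.flip x) = y

end GaussCode

/-- An oriented knot diagram on the sphere (with at least one crossing), up to planar isotopy: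
a signed Gauss code whose surface has Euler characteristic `n - 2 n + #faces = 2`. -/
structure KnotDiagram extends GaussCode where
  planar : Nat.card toGaussCode.Face = n + 2

namespace KnotDiagram

variable (D : KnotDiagram)

/-- The Wirtinger relators.  The generator attached to a passage `p` is the meridian of the edge
that leaves `p`; the edge that arrives at `p` is the one that leaves `next⁻¹ p`.
At an over-passage the two edges belong to the same arc.  At an under-passage with incoming arc `i`,
outgoing arc `j` and over-arc `k`, the relator is `j⁻¹ k⁻¹ i k` if the crossing is positive and
`j⁻¹ k i k⁻¹` if it is negative. -/
def relator : Fin D.n × Bool → FreeGroup (Fin D.n × Bool)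
  | (c, true) => (FreeGroup.of (c, true))⁻¹ * FreeGroup.of (D.next.symm (c, true))
  | (c, false) =>
      let i := FreeGroup.of (D.next.symm (c, false))
      let j := FreeGroup.of (c, false)
      let k := FreeGroup.of (c, true)
      if D.positive c then j⁻¹ * k⁻¹ * i * k else j⁻¹ * k * i * k⁻¹

/-- The knot group, by its Wirtinger presentation. -/
abbrev Group : Type := PresentedGroup (Set.range D.relator)

/-- The Wirtinger generator (a meridian) of the edge that leaves the passage `p`. -/
def meridian (p : Fin D.n × Bool) : D.Group := PresentedGroup.of p

/-- The loop `m_i m_j` that winds the crossing `c`, where `m_i` is the meridian of the incoming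
under-arc and `m_j` the meridian of the over-arc at `c`. -/
def crossingLoop (c : Fin D.n) : D.Group :=
  D.meridian (D.next.symm (c, false)) * D.meridian (c, true)

/-- `g` is a crossing loop at `c`.  A loop is considered up to free homotopy and orientation; this
covers the products, in either order, of the over-meridian with the incoming or the outgoing
under-meridian. -/
def IsCrossingLoop (c : Fin D.n) (g : D.Group) : Prop :=
  IsConj (D.crossingLoop c) g ∨ IsConj (D.crossingLoop c) g⁻¹

/-- Parabolic representations: non-abelian `SL(2, ℂ)`-representations such that meridians
have trace `2` and are not sent to the identity. -/
def Rpar : Set (D.Group →* Matrix.SpecialLinearGroup (Fin 2) ℂ) :=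
  {ρ | (∃ g h, ρ g * ρ h ≠ ρ h * ρ g) ∧
    ∀ p, (ρ (D.meridian p)).1.trace = 2 ∧ ρ (D.meridian p) ≠ 1}

/-- The character variety of parabolic representations, the quotient of `Rpar` by equality of all
traces.  A class is given by its character `g ↦ tr ρ(g)`. -/
def Xpar : Set (D.Group → ℂ) :=
  (fun ρ g => (ρ g).1.trace) '' D.Rpar

/-- The zero-dimensional part of `Xpar`: the points that are isolated for the Zariski topology,
whose closed sets are cut out by complex polynomials in the traces `tr ρ(g)`.
It is all of `Xpar` if `Xpar` is finite. -/
def XparZero : Set (D.Group → ℂ) :=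
  {χ ∈ D.Xpar | ∃ P : MvPolynomial D.Group ℂ,
    ∀ ψ ∈ D.Xpar, MvPolynomial.eval ψ P ≠ 0 ↔ ψ = χ}

/-- The `y`-value at the crossing `c`. -/
def yValue (c : Fin D.n) (χ : D.Group → ℂ) : ℂ := 2 - χ (D.crossingLoop c)

/-- The partial Riley polynomial at `c` of a finite set `S` of characters. -/
def partialRiley (c : Fin D.n) (S : Set (D.Group → ℂ)) : ℂ[X] :=
  ∏ᶠ χ ∈ S, (X - C (D.yValue c χ))

/-- The (generalized) Riley polynomial at `c`. -/
def riley (c : Fin D.n) : ℂ[X] := D.partialRiley c D.XparZero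

end KnotDiagram

/-- The Zariski topology over `ℚ` on `ℂ^ι`: the basic open sets are the non-vanishing loci of
polynomials with rational coefficients. -/
abbrev rationalZariski (ι : Type*) : TopologicalSpace (ι → ℂ) :=
  TopologicalSpace.generateFrom
    {U | ∃ P : MvPolynomial ι ℚ, U = {x | MvPolynomial.aeval x P ≠ 0}}

namespace KnotDiagram

/-- `Y` is an irreducible component, over `ℚ`, of the (zero-dimensional) character variety. -/
def IsComponent (D : KnotDiagram) (Y : Set (D.Group → ℂ)) : Prop :=
  Maximal (fun S => S ⊆ D.XparZero ∧ @IsIrreducible _ (rationalZariski D.Group) S) Y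

/-- The map `φ^*`, `ρ' ↦ ρ' ∘ φ`, on the level of characters. -/
def pullback {D D' : KnotDiagram} (φ : D.Group →* D'.Group) (χ : D'.Group → ℂ) : D.Group → ℂ :=
  fun g => χ (φ g)

/-- `φ^*` is a map from the (zero-dimensional) character variety of `D'` to that of `D`. -/
def PullsBack {D D' : KnotDiagram} (φ : D.Group →* D'.Group) : Prop :=
  Set.MapsTo (pullback φ) D'.XparZero D.XparZero

end KnotDiagram

/-- Every irreducible factor of `p` divides `q`.  Irreducibility is allowed over any subfield `F` of
`ℂ`, in particular over `ℚ`. -/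
def IrreducibleFactorsDivide (p q : ℂ[X]) : Prop :=
  ∀ (F : Subfield ℂ) (f : F[X]), Irreducible f → f.map F.subtype ∣ p → f.map F.subtype ∣ q

end

/-! Crossing loops are fixed up to conjugation and inversion, which traces in `SL(2, ℂ)` do not see.
Hence `φ α = α'` makes `pullback φ` preserve y-values, and roots of `R'` are roots of `R`.
Irreducible factors have simple roots, so they divide `R`. If `φ` is onto, `pullback φ` is
injective, so multiplicities survive as well. Equality needs `pullback φ` to be onto. For whole
varieties the inverse supplies this. For components it is automatic: each is a single orbit of the
automorphisms of `ℂ`, which commute with `pullback φ` (`IsComponent.eq_orbit`). The orbit claim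
rests on `xparZero_finite`, which also makes the products genuine, and on extending isomorphisms of
countable subrings to `ℂ`. -/

/-- Two injective homomorphisms from a countable ring to uncountable algebraically closed fields of
the same cardinality differ by an isomorphism of the fields. -/
theorem exists_ringEquiv_algebraMap_eq.{u} {R : Type*} {K L : Type u} [CommRing R] [Countable R]
    [Field K] [Field L] [IsAlgClosed K] [IsAlgClosed L] [Algebra R K] [Algebra R L]
    (hRK : Function.Injective (algebraMap R K)) (hRL : Function.Injective (algebraMap R L))
    (hK : Cardinal.aleph0 < Cardinal.mk K) (hKL : Cardinal.mk K = Cardinal.mk L) :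
    ∃ σ : K ≃+* L, ∀ r, σ (algebraMap R K r) = algebraMap R L r := by
  have : IsDomain R := hRK.isDomain
  have : FaithfulSMul R K := (faithfulSMul_iff_algebraMap_injective R K).2 hRK
  have : FaithfulSMul R L := (faithfulSMul_iff_algebraMap_injective R L).2 hRL
  obtain ⟨s, hs⟩ := exists_isTranscendenceBasis R K
  obtain ⟨t, ht⟩ := exists_isTranscendenceBasis R L
  -- Over a countable base, a transcendence basis is as large as the uncountable field, so the two
  -- bases biject.
  have hKs : Cardinal.mk K = Cardinal.mk s := by
    simpa using IsAlgClosed.cardinal_eq_cardinal_transcendence_basis_of_aleph0_lt _ hs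
      Cardinal.mk_le_aleph0 hK
  have hLt : Cardinal.mk L = Cardinal.mk t := by
    simpa using IsAlgClosed.cardinal_eq_cardinal_transcendence_basis_of_aleph0_lt _ ht
      Cardinal.mk_le_aleph0 (hKL ▸ hK)
  obtain ⟨e⟩ := Cardinal.eq.1 (hKs.symm.trans (hKL.trans hLt))
  let := IsAlgClosed.isAlgClosure_of_transcendence_basis _ hs
  let := IsAlgClosed.isAlgClosure_of_transcendence_basis _ ht
  let ε := (hs.1.aevalEquiv.symm.trans (MvPolynomial.renameEquiv R e)).trans ht.1.aevalEquiv
  refine ⟨IsAlgClosure.equivOfEquiv K L ε.toRingEquiv, fun r => ?_⟩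
  rw [IsScalarTower.algebraMap_apply R (Algebra.adjoin R (Set.range ((↑) : s → K))) K,
    IsAlgClosure.equivOfEquiv_algebraMap,
    IsScalarTower.algebraMap_apply R (Algebra.adjoin R (Set.range ((↑) : t → L))) L]
  exact congrArg _ (ε.commutes r)

/-- Two homomorphisms from a countable ring to `ℂ` with the same kernel differ by an automorphism
of `ℂ`. -/
theorem Complex.exists_ringEquiv_comp_eq {R : Type*} [CommRing R] [Countable R] (f g : R →+* ℂ)
    (h : RingHom.ker f = RingHom.ker g) : ∃ σ : ℂ ≃+* ℂ, ∀ r, σ (f r) = g r := by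
  let f' : R ⧸ RingHom.ker f →+* ℂ := RingHom.kerLift f
  let g' : R ⧸ RingHom.ker f →+* ℂ := Ideal.Quotient.lift _ g fun a ha => by
    rw [h] at ha; exact ha
  have hf' : Function.Injective f' := RingHom.kerLift_injective f
  have hg' : Function.Injective g' := by
    refine RingHom.lift_injective_of_ker_le_ideal _ _ ?_
    rw [h]
  have : Countable (R ⧸ RingHom.ker f) := Quotient.countable
  obtain ⟨σ, hσ⟩ := @exists_ringEquiv_algebraMap_eq (R ⧸ RingHom.ker f) ℂ ℂ _ _ _ _ _ _
    f'.toAlgebra g'.toAlgebra hf' hg'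
    (by rw [Cardinal.mk_complex]; exact Cardinal.aleph0_lt_continuum) rfl
  exact ⟨σ, fun r => hσ (Ideal.Quotient.mk _ r)⟩

/-- Each `t + k` is transcendental too, so some automorphism moves `t` to it. -/
theorem Complex.infinite_orbit_of_transcendental {t : ℂ} (ht : Transcendental ℚ t) :
    (Set.range fun σ : ℂ ≃+* ℂ => σ t).Infinite := by
  have key : ∀ k : ℕ, ∃ σ : ℂ ≃+* ℂ, σ t = t + k := by
    intro k
    have htk : Transcendental ℚ (t + k) := fun h =>
      ht (by simpa using h.sub (isAlgebraic_natCast k))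
    have h1 : Function.Injective (aeval t : ℚ[X] →ₐ[ℚ] ℂ) := transcendental_iff_injective.1 ht
    have h2 : Function.Injective (aeval (t + k) : ℚ[X] →ₐ[ℚ] ℂ) :=
      transcendental_iff_injective.1 htk
    have : Countable ℚ[X] := by
      rw [← Cardinal.mk_le_aleph0_iff]
      exact Polynomial.cardinalMk_le_max.trans (by simp)
    obtain ⟨σ, hσ⟩ := Complex.exists_ringEquiv_comp_eq
      (aeval t : ℚ[X] →ₐ[ℚ] ℂ).toRingHom (aeval (t + k) : ℚ[X] →ₐ[ℚ] ℂ).toRingHom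
      (((RingHom.injective_iff_ker_eq_bot _).1 h1).trans
        ((RingHom.injective_iff_ker_eq_bot _).1 h2).symm)
    exact ⟨σ, by simpa using hσ X⟩
  choose σ hσ using key
  refine (Set.infinite_range_of_injective (f := fun k : ℕ => t + (k : ℂ)) fun a b hab => by
    simpa using hab).mono ?_
  rintro _ ⟨k, rfl⟩
  exact ⟨σ k, hσ k⟩

/-! ### Galois orbits and the Zariski topology over `ℚ` -/

theorem aeval_ringEquiv_comp {ι : Type*} (σ : ℂ ≃+* ℂ) (x : ι → ℂ) (P : MvPolynomial ι ℚ) :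
    MvPolynomial.aeval (σ ∘ x) P = σ (MvPolynomial.aeval x P) := by
  induction P using MvPolynomial.induction_on with
  | C a => simp
  | add p q hp hq => simp [hp, hq]
  | mul_X p i hp => simp [hp]

theorem isClosed_rationalZariski_setOf_aeval_eq_zero {ι : Type*} (P : MvPolynomial ι ℚ) :
    @IsClosed _ (rationalZariski ι) {x : ι → ℂ | MvPolynomial.aeval x P = 0} := by
  let := rationalZariski ι
  exact ⟨TopologicalSpace.isOpen_generateFrom_of_mem ⟨P, rfl⟩⟩

theorem ringEquiv_comp_mem_of_isOpen_rationalZariski {ι : Type*} {U : Set (ι → ℂ)}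
    (hU : @IsOpen _ (rationalZariski ι) U) (σ : ℂ ≃+* ℂ) {x : ι → ℂ} (hx : x ∈ U) :
    σ ∘ x ∈ U := by
  induction hU with
  | basic s hs =>
    obtain ⟨P, rfl⟩ := hs
    simpa [aeval_ringEquiv_comp] using hx
  | univ => trivial
  | inter s t _ _ hs ht => exact ⟨hs hx.1, ht hx.2⟩
  | sUnion S _ h =>
    obtain ⟨s, hs, hxs⟩ := hx
    exact ⟨s, hs, h s hs hxs⟩

/-- All points of an orbit lie in the same rational open sets, so opens that meet the orbit share
`x`. -/
theorem isIrreducible_rationalZariski_orbit {ι : Type*} (x : ι → ℂ) :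
    @IsIrreducible _ (rationalZariski ι) (Set.range fun σ : ℂ ≃+* ℂ => σ ∘ x) := by
  let := rationalZariski ι
  have back : ∀ {U : Set (ι → ℂ)}, @IsOpen _ (rationalZariski ι) U → ∀ σ : ℂ ≃+* ℂ,
      (σ : ℂ → ℂ) ∘ x ∈ U → x ∈ U := by
    intro U hU σ h
    have := ringEquiv_comp_mem_of_isOpen_rationalZariski hU σ.symm h
    rwa [← Function.comp_assoc, show (σ.symm : ℂ → ℂ) ∘ σ = id from σ.symm_comp_self,
      Function.id_comp] at this
  refine ⟨⟨_, RingEquiv.refl _, rfl⟩, ?_⟩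
  rintro U V hU hV ⟨_, ⟨σ, rfl⟩, hxU⟩ ⟨_, ⟨τ, rfl⟩, hxV⟩
  exact ⟨x, ⟨RingEquiv.refl _, rfl⟩, back hU σ hxU, back hV τ hxV⟩

/-- A finite set that is irreducible over `ℚ` has a generic point. -/
theorem exists_generic_of_isIrreducible_rationalZariski {ι : Type*} {S : Set (ι → ℂ)}
    (hS : @IsIrreducible _ (rationalZariski ι) S) (hfin : S.Finite) :
    ∃ x ∈ S, ∀ y ∈ S, ∀ P : MvPolynomial ι ℚ,
      MvPolynomial.aeval x P = 0 → MvPolynomial.aeval y P = 0 := by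
  classical
  -- The closures of the finitely many points cover `S`, so one of them contains `S`.
  obtain ⟨z, hz, hSz⟩ := (@isIrreducible_iff_sUnion_isClosed _ (rationalZariski ι) S).1 hS
    (hfin.toFinset.image fun x => @closure _ (rationalZariski ι) {x})
    (by
      intro z hz
      obtain ⟨x, -, rfl⟩ := Finset.mem_image.1 hz
      exact @isClosed_closure _ (rationalZariski ι) _)
    (fun x hx => ⟨@closure _ (rationalZariski ι) {x}, by
      simpa using ⟨x, hx, rfl⟩, @subset_closure _ (rationalZariski ι) {x} x rfl⟩)
  obtain ⟨x, hx, rfl⟩ := Finset.mem_image.1 hz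
  refine ⟨x, by simpa using hx, fun y hy P hP => ?_⟩
  exact @closure_minimal _ (rationalZariski ι) {x} {z | MvPolynomial.aeval z P = 0}
    (by simpa using hP) (isClosed_rationalZariski_setOf_aeval_eq_zero P) y (hSz hy)

/-- A point in the closure, over `ℚ`, of a point with algebraic coordinates is conjugate to it. -/
theorem exists_ringEquiv_comp_eq_of_forall_aeval {ι : Type*} [Countable ι] {x y : ι → ℂ}
    (hx : ∀ i, IsAlgebraic ℚ (x i))
    (h : ∀ P : MvPolynomial ι ℚ, MvPolynomial.aeval x P = 0 → MvPolynomial.aeval y P = 0) :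
    ∃ σ : ℂ ≃+* ℂ, σ ∘ x = y := by
  have hconv : ∀ P : MvPolynomial ι ℚ,
      MvPolynomial.aeval y P = 0 → MvPolynomial.aeval x P = 0 := by
    intro P hP
    by_contra hne
    have halg : IsIntegral ℚ (MvPolynomial.aeval x P) := by
      have hmem : MvPolynomial.aeval x P ∈ integralClosure ℚ ℂ := by
        have : MvPolynomial.aeval x P ∈ Algebra.adjoin ℚ (Set.range x) := by
          rw [Algebra.adjoin_range_eq_range_aeval]; exact ⟨P, rfl⟩
        refine Algebra.adjoin_le ?_ this
        rintro _ ⟨i, rfl⟩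
        exact (hx i).isIntegral
      exact hmem
    -- The minimal polynomial of `P(x)`, composed with `P`, vanishes at `x`, hence at `y`. As `P(y)
    -- = 0`, its constant term is zero, which forces `P(x) = 0`.
    have h0 := h (aeval P (minpoly ℚ (MvPolynomial.aeval x P))) (by
      rw [← Polynomial.aeval_algHom_apply, minpoly.aeval])
    rw [← Polynomial.aeval_algHom_apply, hP, ← Polynomial.coeff_zero_eq_aeval_zero'] at h0
    exact minpoly.coeff_zero_ne_zero halg hne (by simpa using h0)
  have : Countable (MvPolynomial ι ℚ) := by
    rw [← Cardinal.mk_le_aleph0_iff]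
    refine (MvPolynomial.cardinalMk_le_max_lift (σ := ι) (R := ℚ)).trans ?_
    simp
  obtain ⟨σ, hσ⟩ := Complex.exists_ringEquiv_comp_eq
    (MvPolynomial.aeval x : MvPolynomial ι ℚ →ₐ[ℚ] ℂ).toRingHom
    (MvPolynomial.aeval y : MvPolynomial ι ℚ →ₐ[ℚ] ℂ).toRingHom
    (Ideal.ext fun P => ⟨h P, hconv P⟩)
  exact ⟨σ, funext fun i => by simpa using hσ (MvPolynomial.X i)⟩

theorem Matrix.SpecialLinearGroup.trace_inv_fin_two {R : Type*} [CommRing R]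
    (A : Matrix.SpecialLinearGroup (Fin 2) R) : (A⁻¹).1.trace = A.1.trace := by
  rw [Matrix.SpecialLinearGroup.coe_inv, Matrix.adjugate_fin_two]
  simp [Matrix.trace_fin_two, add_comm]

/-! ### Finiteness of the set of isolated characters -/

namespace KnotDiagram

variable (D : KnotDiagram)

/-- The matrix entries of the images of the meridians. -/
def coords (ρ : D.Group →* Matrix.SpecialLinearGroup (Fin 2) ℂ) :
    (Fin D.n × Bool) × Fin 2 × Fin 2 → ℂ :=
  fun q => (ρ (D.meridian q.1)).1 q.2.1 q.2.2

theorem exists_entry_eq_eval_coords (g : D.Group) : ∀ i j : Fin 2,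
    ∃ P : MvPolynomial ((Fin D.n × Bool) × Fin 2 × Fin 2) ℂ,
      ∀ ρ : D.Group →* Matrix.SpecialLinearGroup (Fin 2) ℂ,
        (ρ g).1 i j = MvPolynomial.eval (D.coords ρ) P := by
  have hg : g ∈ Subgroup.closure (Set.range D.meridian) := by
    have := PresentedGroup.closure_range_of (Set.range D.relator)
    exact this ▸ Subgroup.mem_top g
  induction hg using Subgroup.closure_induction with
  | mem x hx =>
    obtain ⟨p, rfl⟩ := hx
    exact fun i j => ⟨MvPolynomial.X (p, i, j), fun ρ => by simp [coords]⟩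
  | one => exact fun i j => ⟨MvPolynomial.C ((1 : Matrix (Fin 2) (Fin 2) ℂ) i j), fun ρ => by simp⟩
  | mul x y _ _ hx hy =>
    intro i j
    choose P hP using hx
    choose Q hQ using hy
    refine ⟨∑ k, P i k * Q k j, fun ρ => ?_⟩
    simp [Matrix.mul_apply, ← hP, ← hQ]
  | inv x _ hx =>
    choose P hP using hx
    intro i j
    refine ⟨(!![P 1 1, -P 0 1; -P 1 0, P 0 0] : Matrix (Fin 2) (Fin 2) _) i j, fun ρ => ?_⟩
    rw [map_inv, Matrix.SpecialLinearGroup.SL2_inv_expl]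
    fin_cases i <;> fin_cases j <;> simp [hP]

/-- Replaces infinitely many trace coordinates by finitely many matrix entries, where the polynomial
ring is Noetherian. -/
theorem exists_eval_coords_eq_eval_character (P : MvPolynomial D.Group ℂ) :
    ∃ Q : MvPolynomial ((Fin D.n × Bool) × Fin 2 × Fin 2) ℂ,
      ∀ ρ : D.Group →* Matrix.SpecialLinearGroup (Fin 2) ℂ,
        MvPolynomial.eval (D.coords ρ) Q =
          MvPolynomial.eval (fun g => (ρ g).1.trace) P := by
  choose E hE using D.exists_entry_eq_eval_coords
  refine ⟨MvPolynomial.bind₁ (fun g => E g 0 0 + E g 1 1) P, fun ρ => ?_⟩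
  rw [MvPolynomial.eval, MvPolynomial.eval₂Hom_bind₁]
  simp only [Matrix.trace_fin_two, hE, map_add]
  rfl

theorem xparZero_finite : D.XparZero.Finite := by
  classical
  have hsep : ∀ χ : D.XparZero, ∃ Q : MvPolynomial ((Fin D.n × Bool) × Fin 2 × Fin 2) ℂ,
      ∀ ρ ∈ D.Rpar, MvPolynomial.eval (D.coords ρ) Q ≠ 0 ↔ (fun g => (ρ g).1.trace) = χ.1 := by
    rintro ⟨χ, -, P, hP⟩
    obtain ⟨Q, hQ⟩ := D.exists_eval_coords_eq_eval_character P
    exact ⟨Q, fun ρ hρ => by rw [hQ]; exact hP _ ⟨ρ, hρ, rfl⟩⟩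
  choose Q hQ using hsep
  -- Finitely many `Q ψ` generate the ideal of all of them. At a representation whose character is
  -- none of these `ψ` they all vanish, so its own `Q χ` would vanish too.
  obtain ⟨s, hs, hspan⟩ := (Submodule.fg_span_iff_fg_span_finset_subset (Set.range Q)).1
    (IsNoetherian.noetherian (Ideal.span (Set.range Q)))
  obtain ⟨t, rfl⟩ : ∃ t : Finset D.XparZero, t.image Q = s := by
    obtain ⟨t, -, ht⟩ := Finset.subset_set_image_iff.1 (by simpa [Set.image_univ] using hs :
      (s : Set _) ⊆ Q '' Set.univ)
    exact ⟨t, ht⟩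
  refine (t.finite_toSet.image Subtype.val).subset fun χ hχ => ?_
  obtain ⟨ρ, hρ, hρχ⟩ := hχ.1
  by_contra hnot
  refine (hQ ⟨χ, hχ⟩ ρ hρ).2 hρχ ?_
  have hle : Ideal.span (t.image Q : Set (MvPolynomial _ ℂ)) ≤
      RingHom.ker (MvPolynomial.eval (D.coords ρ)) := by
    rw [Ideal.span_le]
    intro P hP
    obtain ⟨ψ, hψ, rfl⟩ := Finset.mem_image.1 (Finset.mem_coe.1 hP)
    by_contra hne
    have hψχ := (hQ ψ ρ hρ).1 hne
    exact hnot ⟨ψ, hψ, hψχ.symm.trans hρχ⟩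
  have hmem : Q ⟨χ, hχ⟩ ∈ Ideal.span (Set.range Q) := Ideal.subset_span ⟨_, rfl⟩
  exact hle (show _ ∈ Submodule.span _ _ from hspan ▸ hmem)

theorem apply_of_isConj {χ : D.Group → ℂ} (hχ : χ ∈ D.Xpar) {g h : D.Group} (hgh : IsConj g h) :
    χ g = χ h := by
  obtain ⟨ρ, -, rfl⟩ := hχ
  obtain ⟨k, rfl⟩ := isConj_iff.1 hgh
  simp only [map_mul, map_inv, Matrix.SpecialLinearGroup.coe_mul]
  rw [Matrix.trace_mul_comm, ← mul_assoc, ← Matrix.SpecialLinearGroup.coe_mul]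
  simp

theorem apply_inv {χ : D.Group → ℂ} (hχ : χ ∈ D.Xpar) (g : D.Group) : χ g⁻¹ = χ g := by
  obtain ⟨ρ, -, rfl⟩ := hχ
  simp only [map_inv, Matrix.SpecialLinearGroup.trace_inv_fin_two]

theorem yValue_eq_of_isCrossingLoop {c : Fin D.n} {α : D.Group} (hα : D.IsCrossingLoop c α)
    {χ : D.Group → ℂ} (hχ : χ ∈ D.Xpar) : D.yValue c χ = 2 - χ α := by
  rcases hα with h | h
  · rw [yValue, D.apply_of_isConj hχ h]
  · rw [yValue, D.apply_of_isConj hχ h, D.apply_inv hχ]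

/-! ### Automorphisms of `ℂ` acting on characters -/

theorem ringEquiv_comp_mem_xpar (σ : ℂ ≃+* ℂ) {χ : D.Group → ℂ} (hχ : χ ∈ D.Xpar) :
    σ ∘ χ ∈ D.Xpar := by
  obtain ⟨ρ, ⟨⟨g, h, hgh⟩, hm⟩, rfl⟩ := hχ
  have hinj : Function.Injective
      (Matrix.SpecialLinearGroup.map (n := Fin 2) (σ : ℂ →+* ℂ)) := by
    intro A B hAB
    ext i j
    have := congrArg (fun M => M.1 i j) hAB
    simpa using this
  have htr : ∀ A : Matrix.SpecialLinearGroup (Fin 2) ℂ,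
      (Matrix.SpecialLinearGroup.map (σ : ℂ →+* ℂ) A).1.trace = σ A.1.trace := fun A => by
    simp [Matrix.trace_fin_two]
  refine ⟨(Matrix.SpecialLinearGroup.map (σ : ℂ →+* ℂ)).comp ρ, ⟨⟨g, h, fun hc => hgh ?_⟩,
    fun p => ⟨?_, fun hc => (hm p).2 ?_⟩⟩, ?_⟩
  · exact hinj (by simpa using hc)
  · simp only [MonoidHom.comp_apply]
    rw [htr, (hm p).1, map_ofNat]
  · exact hinj (by simpa using hc)
  · funext k
    exact htr (ρ k)

theorem ringEquiv_comp_mem_xparZero (σ : ℂ ≃+* ℂ) {χ : D.Group → ℂ} (hχ : χ ∈ D.XparZero) :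
    σ ∘ χ ∈ D.XparZero := by
  obtain ⟨hχ, P, hP⟩ := hχ
  refine ⟨D.ringEquiv_comp_mem_xpar σ hχ, MvPolynomial.map (σ : ℂ →+* ℂ) P, fun ψ hψ => ?_⟩
  have hσψ : σ ∘ (σ.symm ∘ ψ) = ψ := by funext g; simp
  have hev : MvPolynomial.eval ψ (MvPolynomial.map (σ : ℂ →+* ℂ) P) =
      σ (MvPolynomial.eval (σ.symm ∘ ψ) P) := by
    conv_lhs => rw [← hσψ]
    exact (MvPolynomial.map_eval (σ : ℂ →+* ℂ) _ P).symm
  rw [hev, map_ne_zero_iff σ σ.injective, hP _ (D.ringEquiv_comp_mem_xpar σ.symm hψ)]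
  constructor
  · rintro rfl; exact hσψ.symm
  · rintro rfl; funext g; simp

theorem isAlgebraic_of_mem_xparZero {χ : D.Group → ℂ} (hχ : χ ∈ D.XparZero) (g : D.Group) :
    IsAlgebraic ℚ (χ g) := by
  by_contra h
  refine Complex.infinite_orbit_of_transcendental h
    ((D.xparZero_finite.image fun ψ => ψ g).subset ?_)
  rintro _ ⟨σ, rfl⟩
  exact ⟨_, D.ringEquiv_comp_mem_xparZero σ hχ, rfl⟩

instance : Countable D.Group := by
  have : Countable (FreeGroup (Fin D.n × Bool)) := Quot.mk_surjective.countable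
  exact (PresentedGroup.mk_surjective (Set.range D.relator)).countable

variable {D}

/-- A component over `ℚ` is a single Galois orbit. -/
theorem IsComponent.eq_orbit {Y : Set (D.Group → ℂ)} (hY : D.IsComponent Y) {χ : D.Group → ℂ}
    (hχ : χ ∈ Y) : Y = Set.range fun σ : ℂ ≃+* ℂ => σ ∘ χ := by
  obtain ⟨χ₀, hχ₀, hgen⟩ := exists_generic_of_isIrreducible_rationalZariski hY.prop.2
    (D.xparZero_finite.subset hY.prop.1)
  have hsub : Y ⊆ Set.range fun σ : ℂ ≃+* ℂ => σ ∘ χ₀ := fun ψ hψ =>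
    exists_ringEquiv_comp_eq_of_forall_aeval (D.isAlgebraic_of_mem_xparZero (hY.prop.1 hχ₀))
      (hgen ψ hψ)
  -- The orbit of the generic point is irreducible and contains `Y`, so maximality gives equality.
  have heq : Y = Set.range fun σ : ℂ ≃+* ℂ => σ ∘ χ₀ :=
    hY.eq_of_subset ⟨Set.range_subset_iff.2 fun σ =>
      D.ringEquiv_comp_mem_xparZero σ (hY.prop.1 hχ₀), isIrreducible_rationalZariski_orbit χ₀⟩ hsub
  obtain ⟨τ, rfl⟩ := hsub hχ
  rw [heq]
  ext ψ
  constructor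
  · rintro ⟨σ, rfl⟩
    exact ⟨τ.symm.trans σ, by funext g; simp⟩
  · rintro ⟨σ, rfl⟩
    exact ⟨τ.trans σ, rfl⟩

/-! ### Riley polynomials under pullback -/

theorem partialRiley_eq_prod (c : Fin D.n) {S : Set (D.Group → ℂ)} (hS : S.Finite) :
    D.partialRiley c S = ∏ χ ∈ hS.toFinset, (X - C (D.yValue c χ)) :=
  finprod_mem_eq_finite_toFinset_prod _ hS

theorem partialRiley_monic (c : Fin D.n) {S : Set (D.Group → ℂ)} (hS : S.Finite) :
    (D.partialRiley c S).Monic := by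
  rw [partialRiley_eq_prod c hS]
  exact monic_prod_of_monic _ _ fun _ _ => monic_X_sub_C _

theorem partialRiley_isRoot_iff (c : Fin D.n) {S : Set (D.Group → ℂ)} (hS : S.Finite) {y : ℂ} :
    (D.partialRiley c S).IsRoot y ↔ ∃ χ ∈ S, D.yValue c χ = y := by
  rw [partialRiley_eq_prod c hS, isRoot_prod]
  simp [sub_eq_zero, eq_comm]

theorem partialRiley_dvd_of_subset (c : Fin D.n) {S T : Set (D.Group → ℂ)} (hT : T.Finite)
    (h : S ⊆ T) : D.partialRiley c S ∣ D.partialRiley c T := by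
  rw [partialRiley_eq_prod c hT, partialRiley_eq_prod c (hT.subset h)]
  exact Finset.prod_dvd_prod_of_subset _ _ _ (by simpa using h)

variable {D' : KnotDiagram}

theorem pullback_injective {φ : D.Group →* D'.Group} (hφ : Function.Surjective φ) :
    Function.Injective (pullback φ) :=
  hφ.injective_comp_right

theorem partialRiley_image_pullback {c : Fin D.n} {c' : Fin D'.n} {φ : D.Group →* D'.Group}
    (hφ : Function.Surjective φ) {S' : Set (D'.Group → ℂ)}
    (hy : ∀ χ ∈ S', D.yValue c (pullback φ χ) = D'.yValue c' χ) :
    D.partialRiley c (pullback φ '' S') = D'.partialRiley c' S' := by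
  rw [partialRiley, finprod_mem_image (pullback_injective hφ).injOn]
  exact finprod_mem_congr rfl fun χ hχ => by rw [hy χ hχ]

theorem yValue_pullback {c : Fin D.n} {c' : Fin D'.n} {α : D.Group} {α' : D'.Group}
    (hα : D.IsCrossingLoop c α) (hα' : D'.IsCrossingLoop c' α') {φ : D.Group →* D'.Group}
    (hφ : φ α = α') {χ : D'.Group → ℂ} (hχ : χ ∈ D'.Xpar) (hχφ : pullback φ χ ∈ D.Xpar) :
    D.yValue c (pullback φ χ) = D'.yValue c' χ := by
  rw [D.yValue_eq_of_isCrossingLoop hα hχφ, D'.yValue_eq_of_isCrossingLoop hα' hχ, pullback, hφ]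

/-- Precomposition with `φ` commutes with postcomposition by `σ`, so an orbit maps onto an orbit. -/
theorem pullback_image_eq_of_isComponent {φ : D.Group →* D'.Group} {Y : Set (D.Group → ℂ)}
    {Y' : Set (D'.Group → ℂ)} (hY : D.IsComponent Y) (hY' : D'.IsComponent Y')
    (h : Set.MapsTo (pullback φ) Y' Y) : pullback φ '' Y' = Y := by
  obtain ⟨χ, hχ⟩ := hY'.prop.2.1
  rw [hY'.eq_orbit hχ, hY.eq_orbit (h hχ), ← Set.range_comp]
  rfl

end KnotDiagram

theorem irreducibleFactorsDivide_of_isRoot {p q : ℂ[X]} (hp : p ≠ 0)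
    (h : ∀ y, p.IsRoot y → q.IsRoot y) : IrreducibleFactorsDivide p q := by
  intro F f hf hfp
  rcases eq_or_ne q 0 with rfl | hq
  · exact dvd_zero _
  have hf0 : f.map F.subtype ≠ 0 := ne_zero_of_dvd_ne_zero hp hfp
  -- In characteristic zero irreducible polynomials are separable, so containment of root sets
  -- suffices.
  have hsep : (f.map F.subtype).Separable := hf.separable.map
  refine (IsAlgClosed.splits (f.map F.subtype)).dvd_of_roots_le_roots hf0 ?_
  refine (Multiset.le_iff_subset (nodup_roots hsep)).2 fun y hy => ?_
  rw [mem_roots hq]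
  exact h y (((mem_roots hf0).1 hy).dvd hfp)

theorem mainTheorem9 (D D' : KnotDiagram) (c : Fin D.n) (c' : Fin D'.n)
    (α : D.Group) (α' : D'.Group)
    (hα : D.IsCrossingLoop c α) (hα' : D'.IsCrossingLoop c' α')
    (φ : D.Group →* D'.Group) (hφ : φ α = α') :
    (KnotDiagram.PullsBack φ →
      IrreducibleFactorsDivide (D'.riley c') (D.riley c) ∧
      (Function.Surjective φ → D'.riley c' ∣ D.riley c) ∧
      (∀ e : D.Group ≃* D'.Group, e.toMonoidHom = φ →
        KnotDiagram.PullsBack e.symm.toMonoidHom → D'.riley c' = D.riley c)) ∧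
    (∀ (Y : Set (D.Group → ℂ)) (Y' : Set (D'.Group → ℂ)),
      D.IsComponent Y → D'.IsComponent Y' → Set.MapsTo (KnotDiagram.pullback φ) Y' Y →
      IrreducibleFactorsDivide (D'.partialRiley c' Y') (D.partialRiley c Y) ∧
      (Function.Surjective φ → D'.partialRiley c' Y' ∣ D.partialRiley c Y) ∧
      (Function.Bijective φ → D'.partialRiley c' Y' = D.partialRiley c Y)) := by
  have hroots : ∀ (S : Set (D.Group → ℂ)) (S' : Set (D'.Group → ℂ)), S ⊆ D.XparZero →
      S' ⊆ D'.XparZero → Set.MapsTo (KnotDiagram.pullback φ) S' S →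
      (∀ χ ∈ S', D.yValue c (KnotDiagram.pullback φ χ) = D'.yValue c' χ) ∧
      IrreducibleFactorsDivide (D'.partialRiley c' S') (D.partialRiley c S) ∧
      (Function.Surjective φ → D'.partialRiley c' S' ∣ D.partialRiley c S) := by
    intro S S' hS hS' hmap
    have hSfin := D.xparZero_finite.subset hS
    have hSfin' := D'.xparZero_finite.subset hS'
    have hy : ∀ χ ∈ S', D.yValue c (KnotDiagram.pullback φ χ) = D'.yValue c' χ := fun χ hχ =>
      KnotDiagram.yValue_pullback hα hα' hφ (hS' hχ).1 (hS (hmap hχ)).1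
    refine ⟨hy, irreducibleFactorsDivide_of_isRoot
      (KnotDiagram.partialRiley_monic c' hSfin').ne_zero fun y h => ?_, fun hsurj => ?_⟩
    · obtain ⟨χ, hχ, rfl⟩ := (KnotDiagram.partialRiley_isRoot_iff c' hSfin').1 h
      exact (KnotDiagram.partialRiley_isRoot_iff c hSfin).2 ⟨_, hmap hχ, hy χ hχ⟩
    · rw [← KnotDiagram.partialRiley_image_pullback hsurj hy]
      exact KnotDiagram.partialRiley_dvd_of_subset c hSfin hmap.image_subset
  refine ⟨fun hpb => ?_, fun Y Y' hY hY' hmap => ?_⟩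
  · obtain ⟨hy, hirr, hdvd⟩ := hroots _ _ subset_rfl subset_rfl hpb
    refine ⟨hirr, hdvd, ?_⟩
    rintro e rfl hpb'
    have himage : KnotDiagram.pullback e.toMonoidHom '' D'.XparZero = D.XparZero := by
      refine hpb.image_subset.antisymm fun χ hχ => ⟨_, hpb' hχ, ?_⟩
      funext g
      simp [KnotDiagram.pullback]
    rw [KnotDiagram.riley, KnotDiagram.riley, ← himage,
      KnotDiagram.partialRiley_image_pullback e.surjective hy]
  · obtain ⟨hy, hirr, hdvd⟩ := hroots Y Y' hY.prop.1 hY'.prop.1 hmap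
    refine ⟨hirr, hdvd, fun hbij => ?_⟩
    rw [← KnotDiagram.pullback_image_eq_of_isComponent hY hY' hmap,
      KnotDiagram.partialRiley_image_pullback hbij.surjective hy]
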